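/- **Setting.** Fix a set $V$ of program variables, each variable $x$ having a nonempty type (set) $T_x$. For a set $X\subseteq V$ let $\ell^2[X]$ be the Hilbert space with orthonormal basis $\{|m\rangle\}$, where $m$ ranges over all assignments $m\in\prod_{x\in X}T_x$ (types and $V$ may be infinite). Operators are bounded. A *mixed memory* is a positive trace-class operator (of arbitrary trace) on $\ell^2[V]$, or, for two copies $V_1,V_2$ of $V$, on $\ell^2[V_1V_2]=\ell^2[V_1]\otimes\ell^2[V_2]$. A mixed memory $\rho$ on $\ell^2[V_1V_2]$ is *separable* if $\rho=\sum_i\sigma_i\otimes\tau_i$ (convergence in trace norm) with mixed memories $\sigma_i,\tau_i$ over $V_1,V_2$. An operator $U$ on $\ell^2[X]$ acts on $\ell^2[V]$ as $U\otimes\mathrm{id}_{V\setminus X}$, again written $U$. A *binary measurement* $M$ on $\ell^2[X]$ is a pair of bounded operators $M_{\mathsf{true}},M_{\mathsf{false}}$ on $\ell^2[X]$ with $M_{\mathsf{true}}^*M_{\mathsf{true}}+M_{\mathsf{false}}^*M_{\mathsf{false}}=\mathrm{id}$. For such $M$ put $\downarrow_t(\rho):=M_t\,\rho\,M_t^*$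 for mixed memories $\rho$ over $V$, and, for operators $A$ on $\ell^2[V_1V_2]$, $\downarrow^*_t(A):=M_t^*AM_t$, where $M_t$ acts on the variables $X$ of the first copy $V_1$. **Programs** are generated by: applying an isometry $U$ on $\ell^2[X]$ to $X$; initialising $X$ with a normalised $\psi\in\ell^2[X]$; $\mathbf{if}\ M[X]\ \mathbf{then}\ c\ \mathbf{else}\ d$; $\mathbf{while}\ M[X]\ c$; $c;d$; $\mathbf{skip}$ (with $X$ a finite list of distinct variables and $M$ a binary measurement on $\ell^2[X]$). Their denotations map mixed memories over $V$ to mixed memories over $V$ and are, respectively, $\rho\mapsto U\rho U^*$; $\rho\mapsto\psi\psi^*\otimes\mathrm{tr}_X\rho$; $\rho\mapsto[\![c]\!](\downarrow_{\mathsf{true}}\rho)+[\![d]\!](\downarrow_{\mathsf{false}}\rho)$; $\rho\mapsto\sum_{n\ge0}\downarrow_{\mathsf{false}}\big(([\![c]\!]\circ\downarrow_{\mathsf{true}})^n(\rho)\big)$ (sum in trace norm); $[\![d]\!]\circ[\![c]\!]$; the identity. A program $c$ is *terminating* if $\mathrm{tr}[\![c]\!](\rho)=\mathrm{tr}\,\rho$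 for every mixed memory $\rho$ over $V$. **Judgments.** An *expectation* is a positive bounded operator on $\ell^2[V_1V_2]$. For expectations $P,Q$ and programs $c,d$, the judgment $\{P\}\,c\sim d\,\{Q\}$ holds iff for every separable mixed memory $\rho$ over $V_1V_2$ there is a separable mixed memory $\rho'$ over $V_1V_2$ with $\mathrm{tr}_{V_2}\rho'=[\![c]\!](\mathrm{tr}_{V_2}\rho)$, $\mathrm{tr}_{V_1}\rho'=[\![d]\!](\mathrm{tr}_{V_1}\rho)$ and $\mathrm{tr}(P\rho)\le\mathrm{tr}(Q\rho')$. **Theorem (one-sided while rule).** Let $c$ be a program, $X$ a finite list of distinct variables, $M$ a binary measurement on $\ell^2[X]$, and $A,B$ expectations. Suppose that $c$ and $\mathbf{while}\ M[X]\ c$ are terminating and that $$\{A\}\;c\sim\mathbf{skip}\;\{\downarrow^*_{\mathsf{true}}(A)+\downarrow^*_{\mathsf{false}}(B)\}$$ holds. Then $$\{\downarrow^*_{\mathsf{true}}(A)+\downarrow^*_{\mathsf{false}}(B)\}\;\mathbf{while}\ M[X]\ c\sim\mathbf{skip}\;\{B\}$$ holds. -/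

import Mathlib

open scoped ENNReal Topology

noncomputable section

namespace QRHL

universe u v w

/-! ### Hilbert spaces with a labelled orthonormal basis -/

/-- The Hilbert space `ℓ²(S)` of square-summable functions `S → ℂ`, with orthonormal basis
labelled by the (arbitrary) set `S`. This is Mathlib's `lp (fun _ : S => ℂ) 2`, wrapped in a
definition so that its topology is only found through its norm. -/
def L2 (S : Type u) : Type u := lp (fun _ : S => ℂ) 2

instance instNormedAddCommGroupL2 (S : Type u) : NormedAddCommGroup (L2 S) :=
  inferInstanceAs (NormedAddCommGroup (lp (fun _ : S => ℂ) 2))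

instance instInnerProductSpaceL2 (S : Type u) : InnerProductSpace ℂ (L2 S) :=
  inferInstanceAs (InnerProductSpace ℂ (lp (fun _ : S => ℂ) 2))

instance instCompleteSpaceL2 (S : Type u) : CompleteSpace (L2 S) :=
  inferInstanceAs (CompleteSpace (lp (fun _ : S => ℂ) 2))

/-- The coefficients of a vector. -/
def L2.coeff {S : Type u} (ψ : L2 S) : S → ℂ := Subtype.val (p := (· ∈ lp (fun _ : S => ℂ) 2)) ψ

instance instCoeFunL2 (S : Type u) : CoeFun (L2 S) (fun _ => S → ℂ) := ⟨L2.coeff⟩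

/-- Bounded operators on `ℓ²(S)`. -/
abbrev Op (S : Type u) : Type u := L2 S →L[ℂ] L2 S

section Basic

variable {A : Type u} {B : Type v}

theorem L2.norm_sq_eq (ψ : L2 A) : ‖ψ‖ ^ 2 = ∑' a, ‖ψ a‖ ^ 2 := by
  have h := lp.norm_rpow_eq_tsum (E := fun _ : A => ℂ) (p := 2) (by norm_num) ψ
  simp only [ENNReal.toReal_ofNat, Real.rpow_ofNat] at h
  exact h

theorem L2.summable_norm_sq (ψ : L2 A) : Summable fun a => ‖ψ a‖ ^ 2 := by
  have h := (lp.memℓp (E := fun _ : A => ℂ) (p := 2) ψ).summable (by norm_num)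
  simp only [ENNReal.toReal_ofNat, Real.rpow_ofNat] at h
  exact h

/-- The vector of `ℓ²(A)` with the given square-summable coefficients. -/
def L2.mk (f : A → ℂ) (h : Summable fun a => ‖f a‖ ^ 2) : L2 A :=
  (⟨f, memℓp_gen (by simpa using h)⟩ : lp (fun _ : A => ℂ) 2)

theorem L2.mk_apply (f : A → ℂ) (h : Summable fun a => ‖f a‖ ^ 2) (a : A) :
    L2.mk f h a = f a := rfl

theorem L2.add_apply (ψ φ : L2 A) (a : A) : (ψ + φ) a = ψ a + φ a := rfl

theorem L2.smul_apply (c : ℂ) (ψ : L2 A) (a : A) : (c • ψ) a = c * ψ a := rfl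

theorem L2.ext {ψ φ : L2 A} (h : ∀ a, ψ a = φ a) : ψ = φ :=
  lp.ext (E := fun _ : A => ℂ) (p := 2) (funext h)

end Basic

open Classical in
/-- The basis vector `|i⟩`. -/
def ket {S : Type u} (i : S) : L2 S := lp.single (E := fun _ : S => ℂ) 2 i (1 : ℂ)

/-! ### Trace, trace norm, mixed states -/

/-- The trace `∑ i, ⟨i| T |i⟩` (meaningful for trace-class `T`). -/
def trace {S : Type u} (T : Op S) : ℂ := ∑' i, inner ℂ (ket i) (T (ket i))

/-- The trace norm `tr |T|`, where `|T| = √(T* T)`; it may be infinite. -/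
def traceNorm {S : Type u} (T : Op S) : ℝ≥0∞ :=
  ∑' i, ENNReal.ofReal (inner ℂ (ket i) (CFC.abs T (ket i))).re

/-- `T` is trace class. -/
def IsTraceClass {S : Type u} (T : Op S) : Prop := traceNorm T ≠ ∞

/-- Mixed states: positive trace-class operators (not necessarily of trace one). -/
def IsMixed {S : Type u} (ρ : Op S) : Prop := ρ.IsPositive ∧ IsTraceClass ρ

/-- The (unordered, arbitrarily indexed) sum `∑ i, f i` converges to `T` in trace norm. -/
def HasTraceNormSum {ι : Type v} {S : Type u} (f : ι → Op S) (T : Op S) : Prop :=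
  Filter.Tendsto (fun s : Finset ι => traceNorm (T - ∑ i ∈ s, f i)) Filter.atTop (𝓝 0)

open Classical in
/-- The sum `∑ i, f i` with respect to the trace norm (`0` if the sum does not converge; below
it is only applied to families for which it does). -/
def traceNormSum {ι : Type v} {S : Type u} (f : ι → Op S) : Op S :=
  if h : ∃ T, HasTraceNormSum f T then h.choose else 0

/-! ### Tensor products: `ℓ²(A) ⊗ ℓ²(B)` is identified with `ℓ²(A × B)` -/

section Tensor

variable {A : Type u} {B : Type v}

theorem L2.summable_slice (ψ : L2 (A × B)) (b : B) : Summable fun a => ‖ψ (a, b)‖ ^ 2 :=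
  (L2.summable_norm_sq ψ).comp_injective (i := fun a => (a, b))
    (fun _ _ h => (Prod.ext_iff.1 h).1)

/-- The operator `id ⊗ ⟨b|`, mapping `ψ` to `ψ(·, b)`. -/
def slice (b : B) : L2 (A × B) →L[ℂ] L2 A :=
  LinearMap.mkContinuous
    { toFun := fun ψ => L2.mk (fun a => ψ (a, b)) (L2.summable_slice ψ b)
      map_add' := fun _ _ => rfl
      map_smul' := fun _ _ => rfl } 1 (fun ψ => by
        rw [one_mul]
        refine le_of_sq_le_sq ?_ (norm_nonneg _)
        rw [L2.norm_sq_eq, L2.norm_sq_eq]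
        exact tsum_comp_le_tsum_of_inj (L2.summable_norm_sq ψ) (fun _ => sq_nonneg _)
          (i := fun a => (a, b)) (fun _ _ h => (Prod.ext_iff.1 h).1))

theorem slice_apply (b : B) (ψ : L2 (A × B)) (a : A) : slice b ψ a = ψ (a, b) := rfl

theorem summable_iff_slice {f : A × B → ℂ} :
    (Summable fun p => ‖f p‖ ^ 2) ↔ (∀ b, Summable fun a => ‖f (a, b)‖ ^ 2) ∧
      Summable fun b => ∑' a, ‖f (a, b)‖ ^ 2 := by
  rw [← (Equiv.prodComm B A).summable_iff]
  exact summable_prod_of_nonneg (f := fun p : B × A => ‖f (p.2, p.1)‖ ^ 2)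
    (fun _ => sq_nonneg _)

theorem summable_norm_sq_slice (ψ : L2 (A × B)) : Summable fun b => ‖slice b ψ‖ ^ 2 := by
  simp only [L2.norm_sq_eq]
  exact (summable_iff_slice.1 (L2.summable_norm_sq ψ)).2

theorem norm_sq_eq_tsum_slice (ψ : L2 (A × B)) : ‖ψ‖ ^ 2 = ∑' b, ‖slice b ψ‖ ^ 2 := by
  have h : Summable fun p : B × A => ‖ψ (p.2, p.1)‖ ^ 2 :=
    (Equiv.prodComm B A).summable_iff.2 (L2.summable_norm_sq ψ)
  have h' : ∑' p : B × A, ‖ψ (p.2, p.1)‖ ^ 2 = ∑' p : A × B, ‖ψ p‖ ^ 2 :=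
    (Equiv.prodComm B A).tsum_eq (fun p : A × B => ‖ψ p‖ ^ 2)
  rw [L2.norm_sq_eq, ← h', h.tsum_prod' (fun b => L2.summable_slice ψ b)]
  simp only [L2.norm_sq_eq, slice_apply]

theorem summable_ampl (T : Op A) (ψ : L2 (A × B)) :
    Summable fun p : A × B => ‖T (slice p.2 ψ) p.1‖ ^ 2 := by
  refine summable_iff_slice.2 ⟨fun b => L2.summable_norm_sq (T (slice b ψ)), ?_⟩
  have h : ∀ b : B, ∑' a, ‖T (slice b ψ) a‖ ^ 2 = ‖T (slice b ψ)‖ ^ 2 :=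
    fun b => (L2.norm_sq_eq (T (slice b ψ))).symm
  simp only [h]
  refine Summable.of_nonneg_of_le (fun _ => sq_nonneg _) (fun b => ?_)
    ((summable_norm_sq_slice ψ).mul_left (‖T‖ ^ 2))
  rw [← mul_pow]
  exact pow_le_pow_left₀ (norm_nonneg _) (T.le_opNorm _) 2

/-- The operator `T ⊗ id` on `ℓ²(A × B)`: apply `T` to every slice `ψ(·, b)`. -/
def ampl (B : Type v) (T : Op A) : Op (A × B) :=
  LinearMap.mkContinuous
    { toFun := fun ψ => L2.mk (fun p => T (slice p.2 ψ) p.1) (summable_ampl T ψ)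
      map_add' := fun ψ φ => L2.ext fun p => by
        simp only [L2.mk_apply, L2.add_apply, map_add]
      map_smul' := fun c ψ => L2.ext fun p => by
        simp only [L2.mk_apply, L2.smul_apply, map_smul, RingHom.id_apply] } ‖T‖ (fun ψ => by
        refine le_of_sq_le_sq ?_ (by positivity)
        rw [mul_pow, norm_sq_eq_tsum_slice, norm_sq_eq_tsum_slice ψ, ← tsum_mul_left]
        refine (summable_norm_sq_slice _).tsum_le_tsum (fun b => ?_)
          ((summable_norm_sq_slice ψ).mul_left _)
        rw [← mul_pow]
        exact pow_le_pow_left₀ (norm_nonneg _) (T.le_opNorm (slice b ψ)) 2)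

theorem ampl_apply (T : Op A) (ψ : L2 (A × B)) (p : A × B) :
    ampl B T ψ p = T (slice p.2 ψ) p.1 := rfl

/-- The unitary `ℓ²(A) ≃ ℓ²(B)` induced by a relabelling of the basis, `|a⟩ ↦ |e a⟩`. -/
def relabel (e : A ≃ B) : L2 A ≃ₗᵢ[ℂ] L2 B where
  toFun ψ := L2.mk (fun b => ψ (e.symm b)) (e.symm.summable_iff.2 (L2.summable_norm_sq ψ))
  invFun φ := L2.mk (fun a => φ (e a)) (e.summable_iff.2 (L2.summable_norm_sq φ))
  map_add' _ _ := rfl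
  map_smul' _ _ := rfl
  left_inv ψ := L2.ext fun a => by simp only [L2.mk_apply, e.symm_apply_apply]
  right_inv φ := L2.ext fun b => by simp only [L2.mk_apply, e.apply_symm_apply]
  norm_map' ψ := by
    refine (sq_eq_sq₀ (norm_nonneg _) (norm_nonneg _)).1 ?_
    rw [L2.norm_sq_eq, L2.norm_sq_eq]
    exact e.symm.tsum_eq (fun a => ‖ψ a‖ ^ 2)

theorem relabel_apply (e : A ≃ B) (ψ : L2 A) (b : B) : relabel e ψ b = ψ (e.symm b) := rfl

/-- Transport of an operator along a relabelling of the basis. -/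
def conj (e : A ≃ B) (T : Op A) : Op B :=
  ((relabel e).toContinuousLinearEquiv : L2 A →L[ℂ] L2 B) ∘L T ∘L
    ((relabel e).symm.toContinuousLinearEquiv : L2 B →L[ℂ] L2 A)

/-- The tensor product `σ ⊗ τ = (σ ⊗ id)(id ⊗ τ)`. -/
def tensor (σ : Op A) (τ : Op B) : Op (A × B) :=
  ampl B σ * conj (Equiv.prodComm B A) (ampl A τ)

/-- The partial trace over the second factor, `∑ b, (id ⊗ ⟨b|) ρ (id ⊗ |b⟩)`. -/
def partialTraceSnd (ρ : Op (A × B)) : Op A :=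
  traceNormSum fun b : B => slice b ∘L ρ ∘L (slice b).adjoint

/-- The partial trace over the first factor. -/
def partialTraceFst (ρ : Op (A × B)) : Op B :=
  partialTraceSnd (conj (Equiv.prodComm A B) ρ)

/-- Separability: `ρ = ∑ i, σ i ⊗ τ i` for mixed states `σ i`, `τ i`, with convergence in trace
norm. (At most countably many summands of such a sum are nonzero, so the universe of the index
type is immaterial.) -/
def IsSeparable (ρ : Op (A × B)) : Prop :=
  ∃ (ι : Type) (σ : ι → Op A) (τ : ι → Op B), (∀ i, IsMixed (σ i)) ∧ (∀ i, IsMixed (τ i)) ∧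
    HasTraceNormSum (fun i => tensor (σ i) (τ i)) ρ

end Tensor

/-! ### Programs

`V` is the set of all program variables; the variable `x` has type `T x`. -/

/-- Assignments over a set `X` of variables. -/
abbrev Assign {V : Type u} (T : V → Type v) (X : V → Prop) : Type (max u v) :=
  ∀ x : {x : V // X x}, T x.1

/-- Assignments over the set of all program variables. -/
abbrev Mem {V : Type u} (T : V → Type v) : Type (max u v) := ∀ x : V, T x

/-- A binary measurement, given by its Kraus operators `M true`, `M false`. -/
structure BinaryMeasurement (S : Type u) where
  /-- The Kraus operator of an outcome. -/
  kraus : Bool → Op S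
  /-- Completeness. -/
  complete : star (kraus true) * kraus true + star (kraus false) * kraus false = 1

/-- Quantum while-programs. In the first four constructors, `X` is the list of variables
that the command refers to. -/
inductive Program {V : Type u} (T : V → Type v) : Type (max u v)
  /-- Apply the isometry `U` to the variables `X`. -/
  | apply (X : Finset V) (U : L2 (Assign T (· ∈ X)) →ₗᵢ[ℂ] L2 (Assign T (· ∈ X))) : Program T
  /-- Initialise the variables `X` with the normalised state `ψ`. -/
  | init (X : Finset V) (ψ : L2 (Assign T (· ∈ X))) (hψ : ‖ψ‖ = 1) : Program T
  /-- Measure `X` with `M`; run `c` on outcome `true` and `d` on outcome `false`. -/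
  | ifThenElse (X : Finset V) (M : BinaryMeasurement (Assign T (· ∈ X))) (c d : Program T) :
      Program T
  /-- Measure `X` with `M`; on outcome `true` run `c` and repeat, on outcome `false` stop. -/
  | whileDo (X : Finset V) (M : BinaryMeasurement (Assign T (· ∈ X))) (c : Program T) : Program T
  /-- Run `c`, then `d`. -/
  | seq (c d : Program T) : Program T
  /-- Do nothing. -/
  | skip : Program T

section Semantics

variable {V : Type u} {T : V → Type v}

open Classical in
/-- An assignment to all variables is an assignment to `X` and one to the other variables. -/
def split (T : V → Type v) (X : Finset V) :
    Mem T ≃ Assign T (· ∈ X) × Assign T (fun x => ¬ x ∈ X) :=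
  Equiv.piEquivPiSubtypeProd (· ∈ X) T

/-- The operator `U` on the variables `X`, acting on memories over all variables as
`U ⊗ id`. -/
def opOn (X : Finset V) (U : Op (Assign T (· ∈ X))) : Op (Mem T) :=
  conj (split T X).symm (ampl (Assign T (fun x => ¬ x ∈ X)) U)

/-- The map `ρ ↦ K ρ K*`. -/
def sandwich {S : Type u} (K ρ : Op S) : Op S := K * ρ * star K

/-- The unnormalised state after measuring the variables `X` with `M` and getting outcome `t`. -/
def restrict (X : Finset V) (M : BinaryMeasurement (Assign T (· ∈ X))) (t : Bool)
    (ρ : Op (Mem T)) : Op (Mem T) :=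
  sandwich (opOn X (M.kraus t)) ρ

/-- The denotational semantics of a program, as a function on mixed memories. -/
def denot : Program T → Op (Mem T) → Op (Mem T)
  | .apply X U, ρ => sandwich (opOn X U.toContinuousLinearMap) ρ
  | .init X ψ _, ρ => conj (split T X).symm
      (tensor (InnerProductSpace.rankOne ℂ ψ ψ) (partialTraceFst (conj (split T X) ρ)))
  | .ifThenElse X M c d, ρ => denot c (restrict X M true ρ) + denot d (restrict X M false ρ)
  | .whileDo X M c, ρ => traceNormSum fun n : ℕ =>
      restrict X M false ((fun σ => denot c (restrict X M true σ))^[n] ρ)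
  | .seq c d, ρ => denot d (denot c ρ)
  | .skip, ρ => ρ

/-- A program is terminating if it preserves the trace of every mixed memory. -/
def Terminating (c : Program T) : Prop :=
  ∀ ρ : Op (Mem T), IsMixed ρ → trace (denot c ρ) = trace ρ

/-- The relational Hoare judgment `{P} c ~ d {Q}` for expectations `P`, `Q`, i.e. positive
operators over two copies of the program variables. -/
def RHL (P : Op (Mem T × Mem T)) (c d : Program T) (Q : Op (Mem T × Mem T)) : Prop :=
  ∀ ρ : Op (Mem T × Mem T), IsMixed ρ → IsSeparable ρ →
    ∃ ρ' : Op (Mem T × Mem T), IsMixed ρ' ∧ IsSeparable ρ' ∧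
      partialTraceSnd ρ' = denot c (partialTraceSnd ρ) ∧
      partialTraceFst ρ' = denot d (partialTraceFst ρ) ∧
      (trace (P * ρ)).re ≤ (trace (Q * ρ')).re

/-- The dual `A ↦ K* A K` of `restrict`, where `K` is the Kraus operator of the outcome `t`
acting on the variables `X` of the first of the two copies of the program variables. -/
def restrictDual (X : Finset V) (M : BinaryMeasurement (Assign T (· ∈ X))) (t : Bool)
    (A : Op (Mem T × Mem T)) : Op (Mem T × Mem T) :=
  star (ampl (Mem T) (opOn X (M.kraus t))) * A * ampl (Mem T) (opOn X (M.kraus t))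

end Semantics

end QRHL

end

noncomputable section

namespace QRHL

universe u v w

open ContinuousLinearMap

/-! ### Matrix coefficients and the Hilbert–Schmidt norm. -/

section Basis

variable {A : Type u} {B : Type v}

/-! Write `Q` for the sum of the two dual restrictions, and follow the loop on a coupling. Starting
from `ρ₀ = ρ`, apply the hypothesis on `c` to the `true` branch of `ρₙ` to get a separable `ρₙ₊₁`
(`exists_loop_step`). By duality `tr(Q ρₙ) = tr(A ↓true ρₙ) + tr(B ↓false ρₙ)`, so `tr(Q ρₙ) ≤ tr(B
↓false ρₙ) + tr(Q ρₙ₊₁)`. The coupling of the final memories is `ρ' = ∑ₙ ↓false ρₙ`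
(`exists_loop_coupling`).

The first marginal of `ρ'` is the defining series of the loop. For the second, `skip` makes the
marginal of `ρₙ₊₁` that of `↓true ρₙ`, and a measurement on the first copy leaves the total second
marginal alone (`quad_partialTraceFst_add`); hence the second marginals of the summands telescope.
The inequality telescopes too. Both remainders are controlled by `tr ρₙ`, and termination of the
loop forces `tr ρₙ → 0`: the exit branches already carry the whole trace of `ρ`.

Convergence is handled through `ℝ≥0∞`-valued quadratic forms. A series of positive operators is
described by `IsPosSum`, which gives trace-norm convergence once the trace is finite, and
interchanges of sums become Tonelli. `tr(P ρ)` is replaced by the squared Hilbert–Schmidt norm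
`expect P ρ` of `√P √ρ`, which is symmetric in `P` and `ρ`. -/

theorem inner_eq_tsum_coeff (ψ φ : L2 A) :
    inner ℂ ψ φ = ∑' a, φ a * (starRingEnd ℂ) (ψ a) :=
  lp.inner_eq_tsum (𝕜 := ℂ) (G := fun _ : A => ℂ) ψ φ

theorem inner_ket_left (a : A) (ψ : L2 A) : inner ℂ (ket a) ψ = ψ a := by
  have h : inner ℂ (ket a) ψ = ψ a * (starRingEnd ℂ) 1 :=
    @lp.inner_single_left A ℂ _ (fun _ : A => ℂ) _ _ (Classical.decEq A) a (1 : ℂ) ψ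
  simpa using h

theorem ket_apply_self (a : A) : ket a a = 1 := by
  classical
  exact lp.single_apply_self (E := fun _ : A => ℂ) 2 a (1 : ℂ)

theorem ket_apply_of_ne {a b : A} (h : b ≠ a) : ket a b = 0 := by
  classical
  exact lp.single_apply_ne (E := fun _ : A => ℂ) 2 a (1 : ℂ) h

theorem star_ket_apply (a b : A) : (starRingEnd ℂ) (ket a b) = ket b a := by
  rw [← inner_ket_left, inner_conj_symm, inner_ket_left]

/-- A matrix coefficient of an operator, in terms of its adjoint. -/
theorem apply_ket_apply (X : L2 A →L[ℂ] L2 B) (a : A) (b : B) :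
    X (ket a) b = (starRingEnd ℂ) (X.adjoint (ket b) a) := by
  rw [← inner_ket_left, ← inner_ket_left a, inner_conj_symm, adjoint_inner_left]

/-- Operators that agree on the basis are equal. -/
theorem ext_ket {X Y : L2 A →L[ℂ] L2 B} (h : ∀ a, X (ket a) = Y (ket a)) : X = Y := by
  -- The coefficients of `X* ψ` are inner products of `X |a⟩` with `ψ`, so passing to adjoints
  -- avoids a density argument.
  have h' : X.adjoint = Y.adjoint := by
    refine ContinuousLinearMap.ext fun ψ => L2.ext fun a => ?_
    rw [← inner_ket_left, ← inner_ket_left, adjoint_inner_right, adjoint_inner_right, h]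
  rw [← adjoint_adjoint X, h', adjoint_adjoint]

theorem enorm_sq_eq_tsum (ψ : L2 A) : ‖ψ‖ₑ ^ 2 = ∑' a, ‖ψ a‖ₑ ^ 2 := by
  have h (x : ℝ) (hx : 0 ≤ x) : ENNReal.ofReal x ^ 2 = ENNReal.ofReal (x ^ 2) :=
    (ENNReal.ofReal_pow hx 2).symm
  simp_rw [← ofReal_norm, h _ (norm_nonneg _)]
  rw [L2.norm_sq_eq, ENNReal.ofReal_tsum_of_nonneg (fun _ => sq_nonneg _) (L2.summable_norm_sq ψ)]

theorem enorm_inner_le (ψ φ : L2 A) : ‖inner ℂ ψ φ‖ₑ ≤ ‖ψ‖ₑ * ‖φ‖ₑ := by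
  rw [← ofReal_norm, ← ofReal_norm, ← ofReal_norm, ← ENNReal.ofReal_mul (norm_nonneg _)]
  exact ENNReal.ofReal_le_ofReal (norm_inner_le_norm ψ φ)

/-- The square of the Hilbert–Schmidt norm of an operator. -/
def hsNormSq (X : L2 A →L[ℂ] L2 B) : ℝ≥0∞ := ∑' a, ‖X (ket a)‖ₑ ^ 2

/-- Both sides are the double sum of squared moduli of matrix entries; Tonelli swaps the order. This
is the form in which cyclicity of the trace is used for positive operators. -/
theorem hsNormSq_adjoint (X : L2 A →L[ℂ] L2 B) : hsNormSq X.adjoint = hsNormSq X := by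
  simp only [hsNormSq, enorm_sq_eq_tsum]
  rw [ENNReal.tsum_comm]
  refine tsum_congr fun a => tsum_congr fun b => ?_
  rw [apply_ket_apply X]
  simp only [← ofReal_norm, RCLike.norm_conj]

theorem enorm_apply_sq_le_hsNormSq (X : L2 A →L[ℂ] L2 B) (ψ : L2 A) :
    ‖X ψ‖ₑ ^ 2 ≤ hsNormSq X * ‖ψ‖ₑ ^ 2 := by
  rw [← hsNormSq_adjoint, enorm_sq_eq_tsum, hsNormSq, ← ENNReal.tsum_mul_right]
  refine ENNReal.tsum_le_tsum fun b => ?_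
  rw [← inner_ket_left, ← adjoint_inner_left, ← mul_pow]
  gcongr
  exact enorm_inner_le _ _

theorem hsNormSq_comp_le {C : Type w} (Y : L2 B →L[ℂ] L2 C) (X : L2 A →L[ℂ] L2 B) :
    hsNormSq (Y ∘L X) ≤ ‖Y‖ₑ ^ 2 * hsNormSq X := by
  rw [hsNormSq, hsNormSq, ← ENNReal.tsum_mul_left]
  refine ENNReal.tsum_le_tsum fun a => ?_
  rw [← mul_pow]
  gcongr
  exact Y.le_opENorm _

end Basis

/-! ### Positive operators, their quadratic forms and traces. -/

section Positive

variable {A : Type u} {B : Type v} {ι : Type w}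

/-- The value `⟨φ| T |φ⟩` of a positive operator. -/
def quad (T : Op A) (φ : L2 A) : ℝ≥0∞ := ENNReal.ofReal (inner ℂ φ (T φ)).re

/-- The trace of a positive operator. -/
def posTrace (T : Op A) : ℝ≥0∞ := ∑' a, quad T (ket a)

theorem quad_ne_top (T : Op A) (φ : L2 A) : quad T φ ≠ ∞ := ENNReal.ofReal_ne_top

theorem inner_eq_quad {T : Op A} (hT : T.IsPositive) (φ : L2 A) :
    inner ℂ φ (T φ) = ((quad T φ).toReal : ℂ) := by
  have h := hT.inner_nonneg_right φ
  rw [quad, ENNReal.toReal_ofReal (Complex.nonneg_iff.1 h).1]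
  exact Complex.ext (by simp) (by simpa using (Complex.nonneg_iff.1 h).2.symm)

theorem quad_add {S T : Op A} (hS : S.IsPositive) (hT : T.IsPositive) (φ : L2 A) :
    quad (S + T) φ = quad S φ + quad T φ := by
  rw [quad, add_apply, inner_add_right, Complex.add_re, ENNReal.ofReal_add
    (Complex.nonneg_iff.1 (hS.inner_nonneg_right φ)).1
    (Complex.nonneg_iff.1 (hT.inner_nonneg_right φ)).1, quad, quad]

theorem posTrace_add {S T : Op A} (hS : S.IsPositive) (hT : T.IsPositive) :
    posTrace (S + T) = posTrace S + posTrace T := by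
  simp only [posTrace, quad_add hS hT, ENNReal.tsum_add]

theorem quad_zero (φ : L2 A) : quad (0 : Op A) φ = 0 := by simp [quad]

theorem quad_sum {F : ι → Op A} (hF : ∀ i, (F i).IsPositive) (s : Finset ι) (φ : L2 A) :
    quad (∑ i ∈ s, F i) φ = ∑ i ∈ s, quad (F i) φ := by
  classical
  induction s using Finset.induction_on with
  | empty => simp [quad_zero]
  | insert i s hi ih =>
    rw [Finset.sum_insert hi, Finset.sum_insert hi, quad_add (hF i) (isPositive_sum s fun i _ => hF i),
      ih]

/-- Positive operators are determined by their quadratic forms. -/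
theorem eq_of_quad_eq {S T : Op A} (hS : S.IsPositive) (hT : T.IsPositive)
    (h : ∀ φ, quad S φ = quad T φ) : S = T := by
  have h' : (S : L2 A →ₗ[ℂ] L2 A) = T := by
    refine (ext_inner_map _ _).1 fun φ => ?_
    rw [coe_coe, coe_coe, hS.inner_left_eq_inner_right, hT.inner_left_eq_inner_right,
      inner_eq_quad hS, inner_eq_quad hT, h]
  exact coe_inj.1 h'

theorem isPositive_of_isSelfAdjoint_mul_self {S : Op A} (hS : IsSelfAdjoint S) :
    (S * S).IsPositive := by
  rw [← nonneg_iff_isPositive]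
  exact hS.mul_self_nonneg

theorem isSelfAdjoint_sqrt (T : Op A) : IsSelfAdjoint (CFC.sqrt T) :=
  IsSelfAdjoint.of_nonneg (CFC.sqrt_nonneg T)

theorem adjoint_sqrt (T : Op A) : (CFC.sqrt T).adjoint = CFC.sqrt T :=
  (isSelfAdjoint_sqrt T).star_eq

theorem sqrt_mul_sqrt {T : Op A} (hT : T.IsPositive) : CFC.sqrt T * CFC.sqrt T = T :=
  CFC.sqrt_mul_sqrt_self T ((nonneg_iff_isPositive T).2 hT)

theorem quad_eq_enorm_sqrt {T : Op A} (hT : T.IsPositive) (φ : L2 A) :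
    quad T φ = ‖CFC.sqrt T φ‖ₑ ^ 2 := by
  have h : inner ℂ φ (T φ) = inner ℂ (CFC.sqrt T φ) (CFC.sqrt T φ) := by
    conv_lhs => rw [← sqrt_mul_sqrt hT, mul_apply_eq_comp, ← adjoint_inner_left, adjoint_sqrt]
  rw [quad, h, ← ofReal_norm, ← ENNReal.ofReal_pow (norm_nonneg _)]
  congr 1
  rw [inner_self_eq_norm_sq_to_K]
  norm_cast

theorem posTrace_eq_hsNormSq_sqrt {T : Op A} (hT : T.IsPositive) :
    posTrace T = hsNormSq (CFC.sqrt T) :=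
  tsum_congr fun a => quad_eq_enorm_sqrt hT (ket a)

theorem quad_le_posTrace_mul {T : Op A} (hT : T.IsPositive) (φ : L2 A) :
    quad T φ ≤ posTrace T * ‖φ‖ₑ ^ 2 := by
  rw [quad_eq_enorm_sqrt hT, posTrace_eq_hsNormSq_sqrt hT]
  exact enorm_apply_sq_le_hsNormSq _ _

theorem quad_le_enorm_mul (T : Op A) (φ : L2 A) : quad T φ ≤ ‖T‖ₑ * ‖φ‖ₑ ^ 2 := by
  calc quad T φ ≤ ‖inner ℂ φ (T φ)‖ₑ := by
        rw [quad, ← ofReal_norm]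
        exact ENNReal.ofReal_le_ofReal (Complex.re_le_norm _)
    _ ≤ ‖φ‖ₑ * ‖T φ‖ₑ := enorm_inner_le _ _
    _ ≤ ‖φ‖ₑ * (‖T‖ₑ * ‖φ‖ₑ) := by gcongr; exact T.le_opENorm _
    _ = ‖T‖ₑ * ‖φ‖ₑ ^ 2 := by ring

/-- The operator norm of `√T` is at most its Hilbert–Schmidt norm, whose square is the trace of `T`;
then use `T = √T √T`. -/
theorem enorm_le_posTrace {T : Op A} (hT : T.IsPositive) : ‖T‖ₑ ≤ posTrace T := by
  by_cases h : posTrace T = ∞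
  · rw [h]; exact le_top
  have hle : ‖CFC.sqrt T‖ ≤ √(posTrace T).toReal := by
    refine opNorm_le_bound _ (Real.sqrt_nonneg _) fun φ => ?_
    refine le_of_sq_le_sq ?_ (by positivity)
    rw [mul_pow, Real.sq_sqrt ENNReal.toReal_nonneg]
    have := ENNReal.toReal_mono (ENNReal.mul_ne_top h (by finiteness)) (quad_le_posTrace_mul hT φ)
    rw [quad_eq_enorm_sqrt hT] at this
    simpa using this
  rw [← ofReal_norm]
  refine ENNReal.ofReal_le_of_le_toReal ?_
  calc ‖T‖ = ‖CFC.sqrt T * CFC.sqrt T‖ := by rw [sqrt_mul_sqrt hT]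
    _ ≤ ‖CFC.sqrt T‖ * ‖CFC.sqrt T‖ := norm_mul_le _ _
    _ ≤ √(posTrace T).toReal * √(posTrace T).toReal := by gcongr
    _ = (posTrace T).toReal := Real.mul_self_sqrt ENNReal.toReal_nonneg

theorem traceNorm_eq_posTrace_abs (T : Op A) : traceNorm T = posTrace (CFC.abs T) := rfl

theorem traceNorm_of_isPositive {T : Op A} (hT : T.IsPositive) : traceNorm T = posTrace T := by
  rw [traceNorm_eq_posTrace_abs, CFC.abs_of_nonneg T ((nonneg_iff_isPositive T).2 hT)]

theorem enorm_le_traceNorm (T : Op A) : ‖T‖ₑ ≤ traceNorm T := by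
  have h : ‖CFC.abs T‖ = ‖T‖ := CFC.norm_abs
  rw [← ofReal_norm, ← h, ofReal_norm]
  exact enorm_le_posTrace ((nonneg_iff_isPositive _).1 (CFC.abs_nonneg T))

theorem isMixed_iff {T : Op A} : IsMixed T ↔ T.IsPositive ∧ posTrace T ≠ ∞ := by
  refine and_congr_right fun h => ?_
  rw [IsTraceClass, traceNorm_of_isPositive h]

theorem trace_of_isMixed {T : Op A} (hT : IsMixed T) : trace T = ((posTrace T).toReal : ℂ) := by
  rw [isMixed_iff] at hT
  rw [trace, posTrace, ENNReal.tsum_toReal_eq (fun a => quad_ne_top T _), Complex.ofReal_tsum]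
  exact tsum_congr fun a => inner_eq_quad hT.1 _

end Positive

/-! ### Series of positive operators. -/

section Sums

variable {A : Type u} {ι : Type w}

/-- The family `F` of positive operators sums to `T`, in the sense of quadratic forms. -/
structure IsPosSum (F : ι → Op A) (T : Op A) : Prop where
  isPositive : ∀ i, (F i).IsPositive
  isPositive_sum : T.IsPositive
  tsum_quad : ∀ φ, ∑' i, quad (F i) φ = quad T φ

theorem IsPosSum.tsum_posTrace {F : ι → Op A} {T : Op A} (h : IsPosSum F T) :
    ∑' i, posTrace (F i) = posTrace T := by
  simp only [posTrace, ← h.tsum_quad]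
  exact ENNReal.tsum_comm

theorem isPositive_sub {S T : Op A} (hS : S.IsPositive) (hT : T.IsPositive)
    (h : ∀ φ, quad S φ ≤ quad T φ) : (T - S).IsPositive := by
  refine (isPositive_iff' _).2 ⟨hT.isSelfAdjoint.sub hS.isSelfAdjoint, fun φ => ?_⟩
  rw [← inner_conj_symm, sub_apply, inner_sub_right, inner_eq_quad hS, inner_eq_quad hT,
    ← Complex.ofReal_sub, Complex.conj_ofReal, Complex.zero_le_real, sub_nonneg]
  exact ENNReal.toReal_mono (quad_ne_top _ _) (h φ)

/-- Each remainder is positive, so its trace norm is its trace, which is the tail of the convergent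
series of traces. Finiteness of the trace of `T` makes the subtraction in `ℝ≥0∞` legitimate. -/
theorem IsPosSum.hasTraceNormSum {F : ι → Op A} {T : Op A} (h : IsPosSum F T)
    (hT : posTrace T ≠ ∞) : HasTraceNormSum F T := by
  have key (s : Finset ι) :
      traceNorm (T - ∑ i ∈ s, F i) = posTrace T - ∑ i ∈ s, posTrace (F i) := by
    have hs := ContinuousLinearMap.isPositive_sum s fun i _ => h.isPositive i
    have hpos : (T - ∑ i ∈ s, F i).IsPositive := by
      refine isPositive_sub hs h.isPositive_sum fun φ => ?_
      rw [quad_sum h.isPositive, ← h.tsum_quad]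
      exact ENNReal.sum_le_tsum s
    have hsum : posTrace (∑ i ∈ s, F i) = ∑ i ∈ s, posTrace (F i) := by
      simp only [posTrace, quad_sum h.isPositive]
      exact Summable.tsum_finsetSum fun _ _ => ENNReal.summable
    have hadd := posTrace_add hpos hs
    rw [sub_add_cancel, hsum] at hadd
    rw [traceNorm_of_isPositive hpos, hadd, ENNReal.add_sub_cancel_right]
    exact ne_top_of_le_ne_top hT (hadd ▸ le_add_self)
  have hlim : Filter.Tendsto (fun s : Finset ι => ∑ i ∈ s, posTrace (F i)) Filter.atTop
      (𝓝 (posTrace T)) := by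
    rw [← h.tsum_posTrace]
    exact ENNReal.summable.hasSum
  have := ENNReal.Tendsto.sub (tendsto_const_nhds (x := posTrace T)) hlim (Or.inl hT)
  rw [tsub_self] at this
  rw [HasTraceNormSum]
  simpa only [key] using this

open scoped ComplexOrder in
/-- A norm-convergent sum of positive operators is a sum of quadratic forms. -/
theorem isPosSum_of_hasSum {F : ι → Op A} {T : Op A} (hF : ∀ i, (F i).IsPositive)
    (h : HasSum F T) : IsPosSum F T := by
  have happ (φ : L2 A) : HasSum (fun i => inner ℂ φ (F i φ)) (inner ℂ φ (T φ)) :=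
    ((innerSL ℂ φ).comp (ContinuousLinearMap.apply ℂ (L2 A) φ)).hasSum h
  have hT : T.IsPositive := by
    have hself : star T = T := by
      refine h.star.unique ?_
      simpa only [(hF _).isSelfAdjoint.star_eq] using h
    refine (isPositive_iff' _).2 ⟨hself, fun φ => ?_⟩
    have h0 : (0 : ℂ) ≤ inner ℂ φ (T φ) := (happ φ).nonneg fun i => (hF i).inner_nonneg_right φ
    have := adjoint_inner_left T φ φ
    rw [show T.adjoint = T from hself] at this
    simpa only [this] using h0
  refine ⟨hF, hT, fun φ => ?_⟩
  have hre := Complex.hasSum_re (happ φ)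
  simp only [quad]
  rw [← ENNReal.ofReal_tsum_of_nonneg
    (fun i => (Complex.nonneg_iff.1 ((hF i).inner_nonneg_right φ)).1) hre.summable, hre.tsum_eq]

/-- A family of positive operators with summable traces is summable. -/
theorem exists_isPosSum {F : ι → Op A} (hF : ∀ i, (F i).IsPositive)
    (h : ∑' i, posTrace (F i) ≠ ∞) : ∃ T, IsPosSum F T := by
  have hs : Summable F := by
    refine Summable.of_norm_bounded (ENNReal.summable_toReal h) fun i => ?_
    rw [← toReal_enorm]
    exact ENNReal.toReal_mono (ENNReal.ne_top_of_tsum_ne_top h i) (enorm_le_posTrace (hF i))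
  exact ⟨_, isPosSum_of_hasSum hF hs.hasSum⟩

/-- The trace norm dominates the operator norm, where limits are unique; hence the choice made in
`traceNormSum` is harmless. -/
theorem HasTraceNormSum.hasSum {F : ι → Op A} {T : Op A} (h : HasTraceNormSum F T) :
    HasSum F T := by
  refine tendsto_iff_edist_tendsto_0.2 ?_
  refine tendsto_of_tendsto_of_tendsto_of_le_of_le tendsto_const_nhds h (fun _ => zero_le)
    fun s => ?_
  simp only
  rw [edist_comm, edist_eq_enorm_sub]
  exact enorm_le_traceNorm _

theorem HasTraceNormSum.traceNormSum_eq {F : ι → Op A} {T : Op A} (h : HasTraceNormSum F T) :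
    traceNormSum F = T := by
  have hex : ∃ T, HasTraceNormSum F T := ⟨T, h⟩
  rw [traceNormSum, dif_pos hex]
  exact hex.choose_spec.hasSum.unique h.hasSum

end Sums

/-! ### The maps `ρ ↦ K ρ K*` and measurements. -/

section Sandwich

variable {A : Type u}

theorem isPositive_sandwich (K : Op A) {ρ : Op A} (hρ : ρ.IsPositive) :
    (sandwich K ρ).IsPositive := hρ.conj_adjoint K

theorem quad_conj_adjoint {B : Type v} (K : L2 A →L[ℂ] L2 B) (ρ : Op A) (φ : L2 B) :
    quad (K ∘L ρ ∘L K.adjoint) φ = quad ρ (K.adjoint φ) := by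
  rw [quad, quad, comp_apply, comp_apply, adjoint_inner_left]

theorem quad_sandwich (K ρ : Op A) (φ : L2 A) :
    quad (sandwich K ρ) φ = quad ρ (K.adjoint φ) := quad_conj_adjoint K ρ φ

/-- The trace of a positive operator compressed by `J`. -/
theorem tsum_quad_comp {B : Type v} {ρ : Op A} (hρ : ρ.IsPositive) (J : L2 B →L[ℂ] L2 A) :
    ∑' b, quad ρ (J (ket b)) = ∑' a, ‖J.adjoint (CFC.sqrt ρ (ket a))‖ₑ ^ 2 := by
  -- The two sides are the squared Hilbert–Schmidt norms of `√ρ J` and of its adjoint `J* √ρ`.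
  have h := hsNormSq_adjoint (CFC.sqrt ρ ∘L J)
  rw [adjoint_comp, adjoint_sqrt] at h
  simp only [quad_eq_enorm_sqrt hρ]
  exact h.symm

theorem posTrace_sandwich (K : Op A) {ρ : Op A} (hρ : ρ.IsPositive) :
    posTrace (sandwich K ρ) = ∑' a, ‖K (CFC.sqrt ρ (ket a))‖ₑ ^ 2 := by
  simp only [posTrace, quad_sandwich]
  rw [tsum_quad_comp hρ, adjoint_adjoint]

/-- Two Kraus operators satisfy the completeness relation. -/
theorem enorm_sq_add_enorm_sq {K L : Op A} (h : star K * K + star L * L = 1) (φ : L2 A) :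
    ‖K φ‖ₑ ^ 2 + ‖L φ‖ₑ ^ 2 = ‖φ‖ₑ ^ 2 := by
  have key : ‖K φ‖ ^ 2 + ‖L φ‖ ^ 2 = ‖φ‖ ^ 2 := by
    have h1 := congrArg (fun T : Op A => (inner ℂ (T φ) φ).re) h
    simp only [add_apply, mul_apply_eq_comp, one_apply_eq_self, inner_add_left, star_eq_adjoint,
      adjoint_inner_left, Complex.add_re] at h1
    have h2 (ψ : L2 A) : (inner ℂ ψ ψ).re = ‖ψ‖ ^ 2 := inner_self_eq_norm_sq (𝕜 := ℂ) ψ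
    simpa only [h2] using h1
  simp only [← ofReal_norm, ← ENNReal.ofReal_pow (norm_nonneg _)]
  rw [← ENNReal.ofReal_add (by positivity) (by positivity), key]

/-- Completeness is a Pythagorean identity for vectors, applied here to each column of `√ρ`. -/
theorem posTrace_sandwich_add {K L : Op A} (h : star K * K + star L * L = 1) {ρ : Op A}
    (hρ : ρ.IsPositive) : posTrace (sandwich K ρ) + posTrace (sandwich L ρ) = posTrace ρ := by
  rw [posTrace_sandwich K hρ, posTrace_sandwich L hρ, ← ENNReal.tsum_add,
    posTrace_eq_hsNormSq_sqrt hρ]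
  exact tsum_congr fun a => enorm_sq_add_enorm_sq h _

theorem isMixed_sandwich (K : Op A) {ρ : Op A} (hρ : IsMixed ρ) : IsMixed (sandwich K ρ) := by
  rw [isMixed_iff] at hρ ⊢
  refine ⟨isPositive_sandwich K hρ.1, ne_top_of_le_ne_top ?_ (?_ : _ ≤ ‖K‖ₑ ^ 2 * posTrace ρ)⟩
  · exact ENNReal.mul_ne_top (by finiteness) hρ.2
  · rw [posTrace_sandwich K hρ.1, posTrace_eq_hsNormSq_sqrt hρ.1]
    exact hsNormSq_comp_le K (CFC.sqrt ρ)

end Sandwich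

/-! ### Expectations `tr(P ρ)`. -/

section Expect

variable {A : Type u} {ι : Type w}

/-- The expectation `tr (P ρ)` for positive operators `P` and `ρ`. -/
def expect (P ρ : Op A) : ℝ≥0∞ := hsNormSq (CFC.sqrt P ∘L CFC.sqrt ρ)

theorem expect_eq_tsum_left {P : Op A} (hP : P.IsPositive) (ρ : Op A) :
    expect P ρ = ∑' a, quad P (CFC.sqrt ρ (ket a)) := by
  simp only [quad_eq_enorm_sqrt hP]
  rfl

/-- `√P √ρ` and `√ρ √P` are adjoint to each other. Symmetry transfers additivity from one argument
to the other. -/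
theorem expect_comm (P ρ : Op A) : expect P ρ = expect ρ P := by
  rw [expect, ← hsNormSq_adjoint, adjoint_comp, adjoint_sqrt, adjoint_sqrt, expect]

theorem expect_add_left {P Q : Op A} (hP : P.IsPositive) (hQ : Q.IsPositive) (ρ : Op A) :
    expect (P + Q) ρ = expect P ρ + expect Q ρ := by
  rw [expect_eq_tsum_left hP, expect_eq_tsum_left hQ, expect_eq_tsum_left (hP.add hQ)]
  simp only [quad_add hP hQ, ENNReal.tsum_add]

theorem IsPosSum.tsum_expect {F : ι → Op A} {T : Op A} (h : IsPosSum F T) (P : Op A) :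
    ∑' i, expect P (F i) = expect P T := by
  simp only [expect_comm P]
  rw [expect_eq_tsum_left h.isPositive_sum]
  simp only [expect_eq_tsum_left (h.isPositive _), ← h.tsum_quad]
  exact ENNReal.tsum_comm

theorem expect_le {P ρ : Op A} (hP : P.IsPositive) (hρ : ρ.IsPositive) :
    expect P ρ ≤ ‖P‖ₑ * posTrace ρ := by
  rw [expect_eq_tsum_left hP, posTrace_eq_hsNormSq_sqrt hρ, hsNormSq, ← ENNReal.tsum_mul_left]
  exact ENNReal.tsum_le_tsum fun a => quad_le_enorm_mul _ _

theorem isPositive_dual (K : Op A) {P : Op A} (hP : P.IsPositive) :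
    (star K * P * K).IsPositive := hP.adjoint_conj K

theorem quad_dual (K P : Op A) (φ : L2 A) : quad (star K * P * K) φ = quad P (K φ) := by
  rw [quad, mul_apply_eq_comp, mul_apply_eq_comp, star_eq_adjoint, adjoint_inner_right, quad]

/-- Both sides are the squared Hilbert–Schmidt norm of `√P K √ρ`, the right one computed from the
adjoint. -/
theorem expect_dual (K : Op A) {P ρ : Op A} (hP : P.IsPositive) (hρ : ρ.IsPositive) :
    expect (star K * P * K) ρ = expect P (sandwich K ρ) := by
  rw [expect_eq_tsum_left (isPositive_dual K hP), expect_comm,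
    expect_eq_tsum_left (isPositive_sandwich K hρ)]
  simp only [quad_dual, quad_sandwich]
  have h := tsum_quad_comp hρ (K.adjoint ∘L CFC.sqrt P)
  rw [adjoint_comp, adjoint_sqrt, adjoint_adjoint] at h
  simp only [quad_eq_enorm_sqrt hP]
  exact h.symm

theorem summable_norm_sq_of_hsNormSq {X : Op A} (h : hsNormSq X ≠ ∞) :
    Summable fun p : A × A => ‖X (ket p.1) p.2‖ ^ 2 := by
  have h' : ∑' p : A × A, ‖X (ket p.1) p.2‖ₑ ^ 2 ≠ ∞ := by
    rw [ENNReal.tsum_prod']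
    simpa only [hsNormSq, enorm_sq_eq_tsum] using h
  simpa using ENNReal.summable_toReal h'

/-- The bound `xy ≤ x² + y²` on entries gives the absolute summability that Fubini needs in
`tsum_inner_adjoint`. -/
theorem summable_mul_star_of_hsNormSq {X Y : Op A} (hX : hsNormSq X ≠ ∞) (hY : hsNormSq Y ≠ ∞) :
    Summable fun p : A × A => Y (ket p.1) p.2 * (starRingEnd ℂ) (X (ket p.1) p.2) := by
  refine Summable.of_norm_bounded
    ((summable_norm_sq_of_hsNormSq hY).add (summable_norm_sq_of_hsNormSq hX)) fun p => ?_
  rw [norm_mul, RCLike.norm_conj]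
  generalize ‖Y (ket p.1) p.2‖ = y, ‖X (ket p.1) p.2‖ = x
  nlinarith [sq_nonneg (x - y), sq_nonneg (x + y)]

/-- Cyclicity of the trace for Hilbert–Schmidt operators. -/
theorem tsum_inner_adjoint {X Y : Op A} (hX : hsNormSq X ≠ ∞) (hY : hsNormSq Y ≠ ∞) :
    ∑' a, inner ℂ (X (ket a)) (Y (ket a)) =
      ∑' a, inner ℂ (Y.adjoint (ket a)) (X.adjoint (ket a)) := by
  have h := Summable.tsum_comm (f := fun a b => Y (ket a) b * (starRingEnd ℂ) (X (ket a) b))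
    (summable_mul_star_of_hsNormSq hX hY)
  have h1 (a : A) := inner_eq_tsum_coeff (X (ket a)) (Y (ket a))
  have h2 (a : A) : inner ℂ (Y.adjoint (ket a)) (X.adjoint (ket a)) =
      ∑' b, Y (ket b) a * (starRingEnd ℂ) (X (ket b) a) := by
    rw [inner_eq_tsum_coeff]
    refine tsum_congr fun b => ?_
    rw [apply_ket_apply Y, apply_ket_apply X, Complex.conj_conj, mul_comm]
  rw [tsum_congr h1, tsum_congr h2]
  exact h.symm

/-- For trace-class positive `ρ` and positive `P`, the trace of `P ρ` is `expect P ρ`. -/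
theorem trace_mul_eq_expect {P ρ : Op A} (hP : P.IsPositive) (hρ : IsMixed ρ) :
    trace (P * ρ) = ((expect P ρ).toReal : ℂ) := by
  rw [isMixed_iff] at hρ
  have hs : hsNormSq (CFC.sqrt ρ) ≠ ∞ := posTrace_eq_hsNormSq_sqrt hρ.1 ▸ hρ.2
  have hadj : (CFC.sqrt ρ ∘L P).adjoint = P ∘L CFC.sqrt ρ := by
    rw [adjoint_comp, adjoint_sqrt, hP.isSelfAdjoint.adjoint_eq]
  have hsP : hsNormSq (CFC.sqrt ρ ∘L P) ≠ ∞ := by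
    rw [← hsNormSq_adjoint, hadj]
    exact ne_top_of_le_ne_top (ENNReal.mul_ne_top (by finiteness) hs) (hsNormSq_comp_le P _)
  -- One factor `√ρ` is moved around the trace: `tr(P √ρ √ρ) = tr(√ρ P √ρ)`, whose diagonal entries
  -- are values of the quadratic form of `P`.
  have h := tsum_inner_adjoint hsP hs
  rw [hadj, adjoint_sqrt] at h
  have h1 (a : A) : inner ℂ (ket a) ((P * ρ) (ket a)) =
      inner ℂ ((CFC.sqrt ρ ∘L P) (ket a)) (CFC.sqrt ρ (ket a)) := by
    conv_lhs => rw [← sqrt_mul_sqrt hρ.1]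
    rw [← adjoint_inner_right, hadj]
    rfl
  rw [trace, tsum_congr h1, h, expect_eq_tsum_left hP,
    ENNReal.tsum_toReal_eq (fun a => quad_ne_top P _), Complex.ofReal_tsum]
  exact tsum_congr fun a => inner_eq_quad hP _

theorem expect_ne_top {P ρ : Op A} (hP : P.IsPositive) (hρ : IsMixed ρ) : expect P ρ ≠ ∞ := by
  rw [isMixed_iff] at hρ
  exact ne_top_of_le_ne_top (ENNReal.mul_ne_top (by finiteness) hρ.2) (expect_le hP hρ.1)

theorem trace_mul_re_le_iff {P Q ρ σ : Op A} (hP : P.IsPositive) (hQ : Q.IsPositive)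
    (hρ : IsMixed ρ) (hσ : IsMixed σ) :
    (trace (P * ρ)).re ≤ (trace (Q * σ)).re ↔ expect P ρ ≤ expect Q σ := by
  rw [trace_mul_eq_expect hP hρ, trace_mul_eq_expect hQ hσ, Complex.ofReal_re, Complex.ofReal_re,
    ENNReal.toReal_le_toReal (expect_ne_top hP hρ) (expect_ne_top hQ hσ)]

end Expect

/-! ### Tensor products and relabellings. -/

section TensorAlgebra

variable {A : Type u} {B : Type v}

theorem ampl_mul (S T : Op A) : ampl B (S * T) = ampl B S * ampl B T := rfl

theorem ampl_one : ampl B (1 : Op A) = 1 := rfl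

theorem ampl_add (S T : Op A) : ampl B (S + T) = ampl B S + ampl B T := rfl

theorem slice_comp_ampl (T : Op A) (b : B) : slice b ∘L ampl B T = T ∘L slice b := rfl

theorem slice_adjoint_ket (a : A) (b : B) : (slice b).adjoint (ket a) = ket (a, b) := by
  refine L2.ext fun p => ?_
  rw [apply_ket_apply, adjoint_adjoint, slice_apply, star_ket_apply]

/-- The operator `φ ↦ φ ⊗ ψ`. -/
def tensorRight (A : Type u) (ψ : L2 B) : L2 A →L[ℂ] L2 (A × B) :=
  LinearMap.mkContinuous
    { toFun := fun φ => L2.mk (fun p => φ p.1 * ψ p.2) (by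
        simpa only [norm_mul, mul_pow] using (L2.summable_norm_sq φ).mul_of_nonneg
          (L2.summable_norm_sq ψ) (fun _ => sq_nonneg _) (fun _ => sq_nonneg _))
      map_add' := fun _ _ => L2.ext fun p => by
        simp only [L2.mk_apply, L2.add_apply, add_mul]
      map_smul' := fun _ _ => L2.ext fun p => by
        simp only [L2.mk_apply, L2.smul_apply, mul_assoc, RingHom.id_apply] } ‖ψ‖ (fun φ => by
        refine le_of_sq_le_sq (le_of_eq ?_) (by positivity)
        rw [mul_pow, norm_sq_eq_tsum_slice, L2.norm_sq_eq ψ, ← tsum_mul_right]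
        refine tsum_congr fun b => ?_
        rw [L2.norm_sq_eq, L2.norm_sq_eq φ, ← tsum_mul_left]
        refine tsum_congr fun a => ?_
        rw [← mul_pow, ← norm_mul, mul_comm]
        rfl)

theorem tensorRight_apply (ψ : L2 B) (φ : L2 A) (p : A × B) :
    tensorRight A ψ φ p = φ p.1 * ψ p.2 := rfl

theorem tensorRight_ket (a : A) (b : B) : tensorRight A (ket b) (ket a) = ket (a, b) := by
  refine L2.ext fun p => ?_
  rw [tensorRight_apply]
  by_cases h : p = (a, b)
  · subst h
    simp only [ket_apply_self, mul_one]
  · rw [ket_apply_of_ne h]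
    by_cases ha : p.1 = a
    · rw [ket_apply_of_ne (a := b) (fun hb => h (Prod.ext ha hb)), mul_zero]
    · rw [ket_apply_of_ne ha, zero_mul]

theorem slice_adjoint (b : B) : (slice b).adjoint = tensorRight A (ket b) :=
  ext_ket fun a => by rw [slice_adjoint_ket, tensorRight_ket]

theorem ampl_tensorRight (T : Op A) (ψ : L2 B) (φ : L2 A) :
    ampl B T (tensorRight A ψ φ) = tensorRight A ψ (T φ) := by
  refine L2.ext fun p => ?_
  have h : slice p.2 (tensorRight A ψ φ) = ψ p.2 • φ := L2.ext fun a => by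
    rw [slice_apply, tensorRight_apply, L2.smul_apply, mul_comm]
  rw [ampl_apply, h, map_smul, L2.smul_apply, tensorRight_apply, mul_comm]

/-- Taking adjoints in `slice_comp_ampl` determines the adjoint of `T ⊗ id` on every product basis
vector. -/
theorem ampl_adjoint (T : Op A) : (ampl B T).adjoint = ampl B T.adjoint := by
  refine ext_ket fun p => ?_
  obtain ⟨a, b⟩ := p
  have h := congrArg adjoint (slice_comp_ampl T b)
  rw [adjoint_comp, adjoint_comp] at h
  have h' := congrArg (fun X => X (ket a)) h
  simp only [comp_apply, slice_adjoint] at h'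
  rw [← tensorRight_ket, h', ampl_tensorRight]

theorem ampl_star (T : Op A) : ampl B (star T) = star (ampl B T) := (ampl_adjoint T).symm

/-- The relabelling as an operator. -/
def relabelL (e : A ≃ B) : L2 A →L[ℂ] L2 B := (relabel e).toContinuousLinearEquiv

theorem relabelL_apply (e : A ≃ B) (ψ : L2 A) (b : B) : relabelL e ψ b = ψ (e.symm b) := rfl

theorem relabelL_ket (e : A ≃ B) (a : A) : relabelL e (ket a) = ket (e a) := by
  refine L2.ext fun b => ?_
  rw [relabelL_apply]
  by_cases h : b = e a
  · rw [h, e.symm_apply_apply, ket_apply_self, ket_apply_self]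
  · rw [ket_apply_of_ne h, ket_apply_of_ne fun h' => h (e.symm_apply_eq.1 h')]

theorem relabelL_adjoint (e : A ≃ B) : (relabelL e).adjoint = relabelL e.symm := by
  refine ext_ket fun b => L2.ext fun a => ?_
  rw [apply_ket_apply, adjoint_adjoint, relabelL_ket, relabelL_ket, star_ket_apply]
  by_cases h : e a = b
  · rw [← h, e.symm_apply_apply, ket_apply_self, ket_apply_self]
  · rw [ket_apply_of_ne h, ket_apply_of_ne fun h' => h (by rw [h', e.apply_symm_apply])]

theorem conj_eq (e : A ≃ B) (T : Op A) :
    conj e T = relabelL e ∘L T ∘L (relabelL e).adjoint := by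
  rw [relabelL_adjoint]
  rfl

theorem conj_mul (e : A ≃ B) (S T : Op A) : conj e (S * T) = conj e S * conj e T := by
  refine ContinuousLinearMap.ext fun φ => ?_
  have h := (relabel e).symm_apply_apply (T ((relabel e).symm φ))
  exact congrArg (fun x => relabel e (S x)) h.symm

theorem conj_one (e : A ≃ B) : conj e (1 : Op A) = 1 :=
  ContinuousLinearMap.ext fun φ => (relabel e).apply_symm_apply φ

theorem conj_add (e : A ≃ B) (S T : Op A) : conj e (S + T) = conj e S + conj e T := rfl

theorem conj_star (e : A ≃ B) (T : Op A) : conj e (star T) = star (conj e T) := by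
  rw [conj_eq, conj_eq, star_eq_adjoint, star_eq_adjoint, adjoint_comp, adjoint_comp,
    adjoint_adjoint, comp_assoc]

theorem isMixed_conj (e : A ≃ B) {T : Op A} (hT : IsMixed T) :
    IsMixed (conj e T) ∧ posTrace (conj e T) = posTrace T := by
  have h : posTrace (conj e T) = posTrace T := by
    simp only [posTrace, conj_eq, quad_conj_adjoint]
    simp only [relabelL_adjoint, relabelL_ket]
    exact e.symm.tsum_eq fun a => quad T (ket a)
  rw [isMixed_iff, h]
  rw [isMixed_iff] at hT
  exact ⟨⟨conj_eq e T ▸ hT.1.conj_adjoint _, hT.2⟩, rfl⟩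

/-- Completeness is inherited by the action on the first factor. -/
theorem ampl_complete {K L : Op A} (h : star K * K + star L * L = 1) :
    star (ampl B K) * ampl B K + star (ampl B L) * ampl B L = 1 := by
  rw [← ampl_star, ← ampl_star, ← ampl_mul, ← ampl_mul, ← ampl_add, h, ampl_one]

theorem conj_complete (e : A ≃ B) {K L : Op A} (h : star K * K + star L * L = 1) :
    star (conj e K) * conj e K + star (conj e L) * conj e L = 1 := by
  rw [← conj_star, ← conj_star, ← conj_mul, ← conj_mul, ← conj_add, h, conj_one]

/-- The operator `id ⊗ τ`. -/
def amplSnd (A : Type u) (τ : Op B) : Op (A × B) := conj (Equiv.prodComm B A) (ampl A τ)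

theorem tensor_eq (σ : Op A) (τ : Op B) : tensor σ τ = ampl B σ * amplSnd A τ := rfl

theorem relabelL_prodComm_tensorRight (ψ : L2 B) (φ : L2 A) :
    relabelL (Equiv.prodComm A B) (tensorRight A ψ φ) = tensorRight B φ ψ :=
  L2.ext fun _ => mul_comm _ _

theorem amplSnd_tensorRight (τ : Op B) (ψ : L2 B) (φ : L2 A) :
    amplSnd A τ (tensorRight A ψ φ) = tensorRight A (τ ψ) φ := by
  rw [amplSnd, conj_eq, relabelL_adjoint, comp_apply, comp_apply, Equiv.prodComm_symm,
    relabelL_prodComm_tensorRight, ampl_tensorRight, relabelL_prodComm_tensorRight]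

theorem commute_ampl_amplSnd (σ : Op A) (τ : Op B) : Commute (ampl B σ) (amplSnd A τ) := by
  refine ext_ket fun p => ?_
  rw [mul_apply_eq_comp, mul_apply_eq_comp, ← tensorRight_ket p.1 p.2, ampl_tensorRight,
    amplSnd_tensorRight, amplSnd_tensorRight, ampl_tensorRight]

theorem amplSnd_mul (S T : Op B) : amplSnd A (S * T) = amplSnd A S * amplSnd A T := by
  rw [amplSnd, ampl_mul, conj_mul, amplSnd, amplSnd]

theorem amplSnd_star (T : Op B) : amplSnd A (star T) = star (amplSnd A T) := by
  rw [amplSnd, ampl_star, conj_star, amplSnd]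

/-- Since the two factors commute, `σ ⊗ τ` is the square of the self-adjoint operator `√σ ⊗ √τ`. -/
theorem isPositive_tensor {σ : Op A} {τ : Op B} (hσ : σ.IsPositive) (hτ : τ.IsPositive) :
    (tensor σ τ).IsPositive := by
  have hc := commute_ampl_amplSnd (CFC.sqrt σ) (CFC.sqrt τ)
  have h : tensor σ τ = (ampl B (CFC.sqrt σ) * amplSnd A (CFC.sqrt τ)) *
      (ampl B (CFC.sqrt σ) * amplSnd A (CFC.sqrt τ)) := by
    conv_lhs => rw [tensor_eq, ← sqrt_mul_sqrt hσ, ← sqrt_mul_sqrt hτ, ampl_mul, amplSnd_mul]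
    exact hc.mul_mul_mul_comm _ _
  rw [h]
  refine isPositive_of_isSelfAdjoint_mul_self ?_
  rw [IsSelfAdjoint, star_mul, ← ampl_star, ← amplSnd_star, (isSelfAdjoint_sqrt σ).star_eq,
    (isSelfAdjoint_sqrt τ).star_eq, hc.eq]

/-- `K* ⊗ id` commutes past `id ⊗ τ`. Product terms stay product terms, so acting on the first copy
preserves separability. -/
theorem sandwich_ampl_tensor (K σ : Op A) (τ : Op B) :
    sandwich (ampl B K) (tensor σ τ) = tensor (sandwich K σ) τ := by
  rw [sandwich, sandwich, tensor_eq, tensor_eq, ampl_mul, ampl_mul, ← ampl_star, mul_assoc,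
    mul_assoc, mul_assoc, mul_assoc, (commute_ampl_amplSnd (star K) τ).eq]

end TensorAlgebra

/-! ### Partial traces. -/

section PartialTrace

variable {A : Type u} {B : Type v} {ι : Type w}

/-- The traces of the compressions add up to the trace of `ρ` by Tonelli over the product basis, so
the defining series converges. -/
theorem isPosSum_partialTraceSnd {ρ : Op (A × B)} (hρ : IsMixed ρ) :
    IsPosSum (fun b : B => slice b ∘L ρ ∘L (slice b).adjoint) (partialTraceSnd ρ) ∧
      posTrace (partialTraceSnd ρ) = posTrace ρ := by
  rw [isMixed_iff] at hρ
  have htr : ∑' b : B, posTrace (slice b ∘L ρ ∘L (slice b).adjoint) = posTrace ρ := by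
    simp only [posTrace, quad_conj_adjoint, slice_adjoint_ket]
    rw [ENNReal.tsum_prod', ENNReal.tsum_comm]
  obtain ⟨T, hT⟩ := exists_isPosSum (fun b : B => hρ.1.conj_adjoint (slice b)) (htr ▸ hρ.2)
  have hTtr := hT.tsum_posTrace.symm.trans htr
  have : partialTraceSnd ρ = T := (hT.hasTraceNormSum (hTtr ▸ hρ.2)).traceNormSum_eq
  rw [this]
  exact ⟨hT, hTtr⟩

theorem quad_partialTraceSnd {ρ : Op (A × B)} (hρ : IsMixed ρ) (φ : L2 A) :
    quad (partialTraceSnd ρ) φ = ∑' b, quad ρ (tensorRight A (ket b) φ) := by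
  rw [← (isPosSum_partialTraceSnd hρ).1.tsum_quad]
  simp only [quad_conj_adjoint]
  simp only [slice_adjoint]

theorem posTrace_partialTraceSnd {ρ : Op (A × B)} (hρ : IsMixed ρ) :
    posTrace (partialTraceSnd ρ) = posTrace ρ := (isPosSum_partialTraceSnd hρ).2

theorem isMixed_partialTraceSnd {ρ : Op (A × B)} (hρ : IsMixed ρ) :
    IsMixed (partialTraceSnd ρ) := by
  obtain ⟨h, h'⟩ := isPosSum_partialTraceSnd hρ
  rw [isMixed_iff] at hρ
  rw [isMixed_iff, h']
  exact ⟨h.isPositive_sum, hρ.2⟩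

theorem isMixed_partialTraceFst {ρ : Op (A × B)} (hρ : IsMixed ρ) :
    IsMixed (partialTraceFst ρ) :=
  isMixed_partialTraceSnd (isMixed_conj _ hρ).1

theorem posTrace_partialTraceFst {ρ : Op (A × B)} (hρ : IsMixed ρ) :
    posTrace (partialTraceFst ρ) = posTrace ρ := by
  rw [partialTraceFst, posTrace_partialTraceSnd (isMixed_conj _ hρ).1, (isMixed_conj _ hρ).2]

theorem quad_partialTraceFst {ρ : Op (A × B)} (hρ : IsMixed ρ) (ψ : L2 B) :
    quad (partialTraceFst ρ) ψ = ∑' a, quad ρ (tensorRight A ψ (ket a)) := by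
  rw [partialTraceFst, quad_partialTraceSnd (isMixed_conj _ hρ).1]
  simp only [conj_eq, quad_conj_adjoint]
  simp only [relabelL_adjoint, Equiv.prodComm_symm,
    relabelL_prodComm_tensorRight]

theorem partialTraceSnd_sandwich_ampl (K : Op A) {ρ : Op (A × B)} (hρ : IsMixed ρ) :
    partialTraceSnd (sandwich (ampl B K) ρ) = sandwich K (partialTraceSnd ρ) := by
  have hρ' := isMixed_sandwich (ampl B K) hρ
  refine eq_of_quad_eq (isMixed_partialTraceSnd hρ').1
    (isPositive_sandwich K (isMixed_partialTraceSnd hρ).1) fun φ => ?_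
  rw [quad_sandwich, quad_partialTraceSnd hρ', quad_partialTraceSnd hρ]
  simp only [quad_sandwich, ampl_adjoint, ampl_tensorRight]

/-- The direct formula involves `K*`, while completeness constrains `K* K`. Taking the adjoint of
the underlying Hilbert–Schmidt operator makes `K` itself act on vectors that do not depend on `K`.
-/
theorem quad_partialTraceFst_sandwich_ampl (K : Op A) {ρ : Op (A × B)} (hρ : IsMixed ρ)
    (ψ : L2 B) : quad (partialTraceFst (sandwich (ampl B K) ρ)) ψ =
      ∑' p, ‖K ((tensorRight A ψ).adjoint (CFC.sqrt ρ (ket p)))‖ₑ ^ 2 := by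
  rw [quad_partialTraceFst (isMixed_sandwich _ hρ)]
  simp only [quad_sandwich, ampl_adjoint, ampl_tensorRight]
  have h := tsum_quad_comp hρ.1 (tensorRight A ψ ∘L K.adjoint)
  rw [adjoint_comp, adjoint_adjoint] at h
  exact h

/-- A measurement on the first factor does not change the marginal on the second one. -/
theorem quad_partialTraceFst_add {K L : Op A} (h : star K * K + star L * L = 1)
    {ρ : Op (A × B)} (hρ : IsMixed ρ) (ψ : L2 B) :
    quad (partialTraceFst (sandwich (ampl B K) ρ)) ψ +
      quad (partialTraceFst (sandwich (ampl B L) ρ)) ψ = quad (partialTraceFst ρ) ψ := by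
  rw [quad_partialTraceFst_sandwich_ampl K hρ, quad_partialTraceFst_sandwich_ampl L hρ,
    quad_partialTraceFst hρ, tsum_quad_comp hρ.1 (tensorRight A ψ), ← ENNReal.tsum_add]
  exact tsum_congr fun p => enorm_sq_add_enorm_sq h _

theorem IsPosSum.partialTraceSnd {F : ι → Op (A × B)} {T : Op (A × B)} (h : IsPosSum F T)
    (hF : ∀ i, IsMixed (F i)) (hT : IsMixed T) :
    IsPosSum (fun i => QRHL.partialTraceSnd (F i)) (QRHL.partialTraceSnd T) where
  isPositive i := (isMixed_partialTraceSnd (hF i)).1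
  isPositive_sum := (isMixed_partialTraceSnd hT).1
  tsum_quad φ := by
    simp only [quad_partialTraceSnd hT, quad_partialTraceSnd (hF _), ← h.tsum_quad]
    exact ENNReal.tsum_comm

theorem IsPosSum.tsum_quad_partialTraceFst {F : ι → Op (A × B)} {T : Op (A × B)}
    (h : IsPosSum F T) (hF : ∀ i, IsMixed (F i)) (hT : IsMixed T) (ψ : L2 B) :
    ∑' i, quad (partialTraceFst (F i)) ψ = quad (partialTraceFst T) ψ := by
  simp only [quad_partialTraceFst hT, quad_partialTraceFst (hF _), ← h.tsum_quad]
  exact ENNReal.tsum_comm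

end PartialTrace

/-! ### Separable states. -/

section Separable

variable {A : Type u} {B : Type v}

/-- Separability of mixed states, in terms of quadratic forms. -/
theorem isSeparable_iff_isPosSum {ρ : Op (A × B)} (hρ : IsMixed ρ) :
    IsSeparable ρ ↔ ∃ (ι : Type) (σ : ι → Op A) (τ : ι → Op B), (∀ i, IsMixed (σ i)) ∧
      (∀ i, IsMixed (τ i)) ∧ IsPosSum (fun i => tensor (σ i) (τ i)) ρ := by
  constructor
  · rintro ⟨ι, σ, τ, hσ, hτ, h⟩
    exact ⟨ι, σ, τ, hσ, hτ,
      isPosSum_of_hasSum (fun i => isPositive_tensor (hσ i).1 (hτ i).1) h.hasSum⟩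
  · rintro ⟨ι, σ, τ, hσ, hτ, h⟩
    exact ⟨ι, σ, τ, hσ, hτ, h.hasTraceNormSum (isMixed_iff.1 hρ).2⟩

theorem isSeparable_sandwich_ampl (K : Op A) {ρ : Op (A × B)} (hρ : IsMixed ρ)
    (h : IsSeparable ρ) : IsSeparable (sandwich (ampl B K) ρ) := by
  obtain ⟨ι, σ, τ, hσ, hτ, h⟩ := (isSeparable_iff_isPosSum hρ).1 h
  refine (isSeparable_iff_isPosSum (isMixed_sandwich _ hρ)).2
    ⟨ι, fun i => sandwich K (σ i), τ, fun i => isMixed_sandwich K (hσ i), hτ,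
      fun i => isPositive_tensor (isPositive_sandwich K (hσ i).1) (hτ i).1,
      isPositive_sandwich _ hρ.1, fun φ => ?_⟩
  simp only [← sandwich_ampl_tensor, quad_sandwich, h.tsum_quad]

/-- The decompositions of the `F n` are concatenated over the index type `Σ n, ι n`. -/
theorem IsPosSum.isSeparable {F : ℕ → Op (A × B)} {T : Op (A × B)} (h : IsPosSum F T)
    (hF : ∀ n, IsMixed (F n)) (hT : IsMixed T) (hsep : ∀ n, IsSeparable (F n)) :
    IsSeparable T := by
  choose ι σ τ hσ hτ hsum using fun n => (isSeparable_iff_isPosSum (hF n)).1 (hsep n)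
  refine (isSeparable_iff_isPosSum hT).2 ⟨Σ n, ι n, fun p => σ p.1 p.2, fun p => τ p.1 p.2,
    fun p => hσ p.1 p.2, fun p => hτ p.1 p.2,
    fun p => isPositive_tensor (hσ p.1 p.2).1 (hτ p.1 p.2).1, h.isPositive_sum, fun φ => ?_⟩
  rw [ENNReal.tsum_sigma', ← h.tsum_quad]
  exact tsum_congr fun n => (hsum n).tsum_quad φ

end Separable

/-! ### Telescoping series in `ℝ≥0∞`. -/

/-- Here `a n` plays the role of what is still in the loop before iteration `n`, and `f n` of what
exits there. -/
theorem eq_sum_range_add_of_forall_eq {a f : ℕ → ℝ≥0∞} (h : ∀ n, f n + a (n + 1) = a n) (n : ℕ) :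
    a 0 = ∑ i ∈ Finset.range n, f i + a n := by
  induction n with
  | zero => simp
  | succ n ih => rw [Finset.sum_range_succ, add_assoc, h, ← ih]

theorem le_sum_range_add_of_forall_le {a f : ℕ → ℝ≥0∞} (h : ∀ n, a n ≤ f n + a (n + 1)) (n : ℕ) :
    a 0 ≤ ∑ i ∈ Finset.range n, f i + a n := by
  induction n with
  | zero => simp
  | succ n ih =>
    rw [Finset.sum_range_succ, add_assoc]
    exact ih.trans (by gcongr; exact h n)

/-- A telescoping sum whose remainder tends to zero. -/
theorem tsum_eq_of_forall_eq {a f : ℕ → ℝ≥0∞} (h : ∀ n, f n + a (n + 1) = a n)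
    (ha : Filter.Tendsto a Filter.atTop (𝓝 0)) : ∑' n, f n = a 0 := by
  have hlim := (ENNReal.tendsto_nat_tsum f).add ha
  rw [add_zero] at hlim
  refine tendsto_nhds_unique hlim ?_
  simp only [← eq_sum_range_add_of_forall_eq h]
  exact tendsto_const_nhds

theorem le_tsum_of_forall_le {a f : ℕ → ℝ≥0∞} (h : ∀ n, a n ≤ f n + a (n + 1))
    (ha : Filter.Tendsto a Filter.atTop (𝓝 0)) : a 0 ≤ ∑' n, f n := by
  have hlim := (ENNReal.tendsto_nat_tsum f).add ha
  rw [add_zero] at hlim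
  exact ge_of_tendsto' hlim fun n => le_sum_range_add_of_forall_le h n

/-- No limit of `a` is assumed: this gives convergence of the exit series before the remainder is
known to vanish. -/
theorem tsum_le_of_forall_eq {a f : ℕ → ℝ≥0∞} (h : ∀ n, f n + a (n + 1) = a n) :
    ∑' n, f n ≤ a 0 :=
  le_of_tendsto' (ENNReal.tendsto_nat_tsum f) fun n =>
    (eq_sum_range_add_of_forall_eq h n).symm ▸ le_self_add

/-- The remainder of a telescoping sum with the full value tends to zero. -/
theorem tendsto_zero_of_tsum_eq {a f : ℕ → ℝ≥0∞} (h : ∀ n, f n + a (n + 1) = a n)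
    (h0 : a 0 ≠ ∞) (hsum : ∑' n, f n = a 0) : Filter.Tendsto a Filter.atTop (𝓝 0) := by
  have hlim := ENNReal.Tendsto.sub (tendsto_const_nhds (x := a 0)) (ENNReal.tendsto_nat_tsum f)
    (Or.inl h0)
  rw [hsum, tsub_self] at hlim
  refine hlim.congr fun n => ?_
  have hn := eq_sum_range_add_of_forall_eq h n
  rw [hn, ENNReal.add_sub_cancel_left]
  exact ne_top_of_le_ne_top h0 (hn ▸ le_self_add)

/-! ### The loop on couplings. -/

section Judgments

variable {V : Type u} {T : V → Type v}

theorem opOn_complete (X : Finset V) (M : BinaryMeasurement (Assign T (· ∈ X))) :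
    star (opOn X (M.kraus true)) * opOn X (M.kraus true) +
      star (opOn X (M.kraus false)) * opOn X (M.kraus false) = 1 :=
  conj_complete _ (ampl_complete M.complete)

/-- The outcome `t` of a measurement on the first copy of the program variables. -/
def restrictFst (X : Finset V) (M : BinaryMeasurement (Assign T (· ∈ X))) (t : Bool)
    (ρ : Op (Mem T × Mem T)) : Op (Mem T × Mem T) :=
  sandwich (ampl (Mem T) (opOn X (M.kraus t))) ρ

variable {X : Finset V} {M : BinaryMeasurement (Assign T (· ∈ X))} {c : Program T}
  {A B : Op (Mem T × Mem T)}

theorem isMixed_restrictFst (t : Bool) {ρ : Op (Mem T × Mem T)} (hρ : IsMixed ρ) :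
    IsMixed (restrictFst X M t ρ) := isMixed_sandwich _ hρ

theorem isSeparable_restrictFst (t : Bool) {ρ : Op (Mem T × Mem T)} (hρ : IsMixed ρ)
    (h : IsSeparable ρ) : IsSeparable (restrictFst X M t ρ) := isSeparable_sandwich_ampl _ hρ h

theorem partialTraceSnd_restrictFst (t : Bool) {ρ : Op (Mem T × Mem T)} (hρ : IsMixed ρ) :
    partialTraceSnd (restrictFst X M t ρ) = restrict X M t (partialTraceSnd ρ) :=
  partialTraceSnd_sandwich_ampl _ hρ

theorem isPositive_restrictDual (t : Bool) (hA : A.IsPositive) :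
    (restrictDual X M t A).IsPositive := isPositive_dual _ hA

theorem expect_restrictDual_add (hA : A.IsPositive) (hB : B.IsPositive)
    {ρ : Op (Mem T × Mem T)} (hρ : IsMixed ρ) :
    expect (restrictDual X M true A + restrictDual X M false B) ρ =
      expect A (restrictFst X M true ρ) + expect B (restrictFst X M false ρ) := by
  rw [expect_add_left (isPositive_restrictDual _ hA) (isPositive_restrictDual _ hB)]
  exact congrArg₂ _ (expect_dual _ hA hρ.1) (expect_dual _ hB hρ.1)

/-- One iteration of the loop, on a coupling of the two memories. -/
theorem exists_loop_step (hA : A.IsPositive) (hB : B.IsPositive)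
    (h : RHL A c .skip (restrictDual X M true A + restrictDual X M false B))
    {ρ : Op (Mem T × Mem T)} (hρ : IsMixed ρ) (hsep : IsSeparable ρ) :
    ∃ ρ' : Op (Mem T × Mem T), IsMixed ρ' ∧ IsSeparable ρ' ∧
      partialTraceSnd ρ' = denot c (restrict X M true (partialTraceSnd ρ)) ∧
      partialTraceFst ρ' = partialTraceFst (restrictFst X M true ρ) ∧
      expect (restrictDual X M true A + restrictDual X M false B) ρ ≤
        expect B (restrictFst X M false ρ) +
          expect (restrictDual X M true A + restrictDual X M false B) ρ' := by
  have hmix := isMixed_restrictFst (X := X) (M := M) true hρ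
  obtain ⟨ρ', hρ', hsep', h2, h1, hle⟩ := h _ hmix (isSeparable_restrictFst true hρ hsep)
  refine ⟨ρ', hρ', hsep', ?_, h1, ?_⟩
  · rw [h2, partialTraceSnd_restrictFst true hρ]
  · rw [expect_restrictDual_add hA hB hρ, add_comm]
    gcongr
    exact (trace_mul_re_le_iff hA ((isPositive_restrictDual true hA).add
      (isPositive_restrictDual false hB)) hmix hρ').1 hle

/-- The final states of the individual iterations add up to a coupling of the final memories. -/
theorem exists_loop_coupling (hw : Terminating (.whileDo X M c))
    {Q : Op (Mem T × Mem T)} (hQ : Q.IsPositive) {r : ℕ → Op (Mem T × Mem T)}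
    (hmix : ∀ n, IsMixed (r n)) (hsep : ∀ n, IsSeparable (r n))
    (hsnd : ∀ n, partialTraceSnd (r (n + 1)) = denot c (restrict X M true (partialTraceSnd (r n))))
    (hfst : ∀ n, partialTraceFst (r (n + 1)) = partialTraceFst (restrictFst X M true (r n)))
    (hle : ∀ n, expect Q (r n) ≤ expect B (restrictFst X M false (r n)) + expect Q (r (n + 1))) :
    ∃ ρ' : Op (Mem T × Mem T), IsMixed ρ' ∧ IsSeparable ρ' ∧
      partialTraceSnd ρ' = denot (.whileDo X M c) (partialTraceSnd (r 0)) ∧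
      partialTraceFst ρ' = partialTraceFst (r 0) ∧ expect Q (r 0) ≤ expect B ρ' := by
  have hKL := opOn_complete X M
  have hfin := fun n => (isMixed_iff.1 (hmix n)).2
  have hF (n : ℕ) := isMixed_restrictFst (X := X) (M := M) false (hmix n)
  -- The trace of `r (n + 1)` is read off its second marginal, which is that of the `true` branch of
  -- `r n`.
  have htr (n : ℕ) : posTrace (restrictFst X M false (r n)) + posTrace (r (n + 1)) =
      posTrace (r n) := by
    rw [← posTrace_partialTraceFst (hmix (n + 1)), hfst,
      posTrace_partialTraceFst (isMixed_restrictFst true (hmix n)), add_comm]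
    exact posTrace_sandwich_add (ampl_complete hKL) (hmix n).1
  have hbound := tsum_le_of_forall_eq (a := fun n => posTrace (r n)) htr
  obtain ⟨ρ', hsum⟩ := exists_isPosSum (fun n => (hF n).1)
    (ne_top_of_le_ne_top (hfin 0) hbound)
  have hρ' : IsMixed ρ' := isMixed_iff.2 ⟨hsum.isPositive_sum,
    ne_top_of_le_ne_top (hfin 0) (hsum.tsum_posTrace ▸ hbound)⟩
  have hden : denot (.whileDo X M c) (partialTraceSnd (r 0)) = partialTraceSnd ρ' := by
    have hit (n : ℕ) : (fun σ => denot c (restrict X M true σ))^[n] (partialTraceSnd (r 0)) =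
        partialTraceSnd (r n) := by
      induction n with
      | zero => rfl
      | succ n ih => rw [Function.iterate_succ_apply', ih, hsnd]
    rw [denot]
    simp only [hit]
    refine HasTraceNormSum.traceNormSum_eq ?_
    simp only [← partialTraceSnd_restrictFst false (hmix _)]
    exact (hsum.partialTraceSnd hF hρ').hasTraceNormSum
      (isMixed_iff.1 (isMixed_partialTraceSnd hρ')).2
  -- Termination of the loop enters here: the exit branches together carry the whole initial trace.
  have hterm : ∑' n, posTrace (restrictFst X M false (r n)) = posTrace (r 0) := by
    have h := hw _ (isMixed_partialTraceSnd (hmix 0))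
    rw [hden, trace_of_isMixed (isMixed_partialTraceSnd hρ'),
      trace_of_isMixed (isMixed_partialTraceSnd (hmix 0)), posTrace_partialTraceSnd hρ',
      posTrace_partialTraceSnd (hmix 0), Complex.ofReal_inj,
      ENNReal.toReal_eq_toReal_iff' (isMixed_iff.1 hρ').2 (hfin 0)] at h
    rw [hsum.tsum_posTrace, h]
  have hlim := tendsto_zero_of_tsum_eq (a := fun n => posTrace (r n)) htr (hfin 0) hterm
  have hlim_mul {C : ℝ≥0∞} (hC : C ≠ ∞) :
      Filter.Tendsto (fun n => C * posTrace (r n)) Filter.atTop (𝓝 0) := by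
    simpa using ENNReal.Tendsto.const_mul hlim (Or.inr hC)
  refine ⟨ρ', hρ', hsum.isSeparable hF hρ' fun n => isSeparable_restrictFst _ (hmix n) (hsep n),
    hden.symm, ?_, ?_⟩
  · refine eq_of_quad_eq (isMixed_partialTraceFst hρ').1 (isMixed_partialTraceFst (hmix 0)).1
      fun ψ => ?_
    rw [← hsum.tsum_quad_partialTraceFst hF hρ']
    refine tsum_eq_of_forall_eq (a := fun n => quad (partialTraceFst (r n)) ψ) (fun n => ?_) ?_
    · rw [hfst, add_comm]
      exact quad_partialTraceFst_add hKL (hmix n) ψ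
    -- The remainder of the second marginal at `ψ` is at most `‖ψ‖²` times the trace of `r n`.
    · refine tendsto_of_tendsto_of_tendsto_of_le_of_le tendsto_const_nhds
        (hlim_mul (C := ‖ψ‖ₑ ^ 2) (by finiteness)) (fun _ => zero_le) fun n => ?_
      simp only
      rw [mul_comm, ← posTrace_partialTraceFst (hmix n)]
      exact quad_le_posTrace_mul (isMixed_partialTraceFst (hmix n)).1 ψ
  · rw [← hsum.tsum_expect B]
    refine le_tsum_of_forall_le (a := fun n => expect Q (r n)) hle ?_
    exact tendsto_of_tendsto_of_tendsto_of_le_of_le tendsto_const_nhds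
      (hlim_mul (C := ‖Q‖ₑ) (by finiteness)) (fun _ => zero_le)
      fun n => expect_le hQ (hmix n).1

end Judgments

end QRHL

end

theorem mainTheorem2 {V : Type*} {T : V → Type*} [∀ x, Nonempty (T x)]
    (X : Finset V) (M : QRHL.BinaryMeasurement (QRHL.Assign T (· ∈ X))) (c : QRHL.Program T)
    (A B : QRHL.Op (QRHL.Mem T × QRHL.Mem T)) (hA : A.IsPositive) (hB : B.IsPositive)
    (hc : QRHL.Terminating c) (hw : QRHL.Terminating (.whileDo X M c))
    (h : QRHL.RHL A c .skip (QRHL.restrictDual X M true A + QRHL.restrictDual X M false B)) :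
    QRHL.RHL (QRHL.restrictDual X M true A + QRHL.restrictDual X M false B)
      (.whileDo X M c) .skip B := by
  intro ρ hρ hsep
  choose f hf using fun r : {ρ : QRHL.Op (QRHL.Mem T × QRHL.Mem T) //
    QRHL.IsMixed ρ ∧ QRHL.IsSeparable ρ} => QRHL.exists_loop_step hA hB h r.2.1 r.2.2
  -- Iteration needs a self-map, so the chosen step acts on the subtype of separable mixed states.
  let r : ℕ → {ρ : QRHL.Op (QRHL.Mem T × QRHL.Mem T) // QRHL.IsMixed ρ ∧ QRHL.IsSeparable ρ} :=
    fun n => (fun s => ⟨f s, (hf s).1, (hf s).2.1⟩)^[n] ⟨ρ, hρ, hsep⟩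
  have hr (n : ℕ) : (r (n + 1)).1 = f (r n) :=
    congrArg Subtype.val (Function.iterate_succ_apply' _ n _)
  have hQ := (QRHL.isPositive_restrictDual (X := X) (M := M) true hA).add
    (QRHL.isPositive_restrictDual (X := X) (M := M) false hB)
  obtain ⟨ρ', hρ', hsep', hsnd, hfst, hle⟩ := QRHL.exists_loop_coupling hw hQ
    (r := fun n => (r n).1) (fun n => (r n).2.1) (fun n => (r n).2.2)
    (fun n => by simpa only [hr] using (hf (r n)).2.2.1)
    (fun n => by simpa only [hr] using (hf (r n)).2.2.2.1)
    (fun n => by simpa only [hr] using (hf (r n)).2.2.2.2)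
  exact ⟨ρ', hρ', hsep', hsnd, hfst, (QRHL.trace_mul_re_le_iff hQ hB hρ hρ').2 hle⟩
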